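/- Let $m$ and $n$ be positive integers, and let $G$ be the $m \times n$ rectangular grid graph: its vertices are the integer points $(x, y)$ with $1 \le x \le m$ and $1 \le y \le n$, and its edges are the unit segments between these points. The signature of a cycle $C$ in $G$ is the function which assigns to each unit square cell of $G$ the number of edges of that cell which belong to $C$. If $C_1$ and $C_2$ are two cycles in $G$ with the same signature, then the number of edges of $G$ which belong to exactly one of $C_1$ and $C_2$ is divisible by $8$. -/

import Mathlib

namespace Slitherlink

/-- The `m × n` rectangular grid graph, sizes being counted in vertices: the vertices are the points
`(x, y)` with `0 ≤ x < m` and `0 ≤ y < n`, and two of them are adjacent exactly when they are at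
distance one in one coordinate and agree in the other one. -/
abbrev grid (m n : ℕ) : SimpleGraph (Fin m × Fin n) :=
  (SimpleGraph.pathGraph m).boxProd (SimpleGraph.pathGraph n)

/-- The unit cells (finite faces) of the `m × n` grid, each labelled by its lower left corner. -/
abbrev Cell (m n : ℕ) : Type := Fin (m - 1) × Fin (n - 1)

/-- The corner of the cell `c` obtained from its lower left corner by adding `(a, b)`, where
`a` and `b` are zero or one. -/
def Cell.corner {m n : ℕ} (c : Cell m n) (a b : Fin 2) : Fin m × Fin n :=
  (⟨c.1 + a, by omega⟩, ⟨c.2 + b, by omega⟩)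

/-- The four edges of a cell: lower, upper, left, right. -/
def Cell.edges {m n : ℕ} (c : Cell m n) : Set (Sym2 (Fin m × Fin n)) :=
  {s(c.corner 0 0, c.corner 1 0), s(c.corner 0 1, c.corner 1 1),
   s(c.corner 0 0, c.corner 0 1), s(c.corner 1 0, c.corner 1 1)}

/-- A subgraph of `G` is a cycle when it consists of the vertices and edges traversed by some
closed walk of `G` that repeats no edge and no vertex (except for its endpoint). -/
def IsCycle {V : Type*} {G : SimpleGraph V} (C : G.Subgraph) : Prop :=
  ∃ (u : V) (w : G.Walk u u), w.IsCycle ∧ w.toSubgraph = C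

/-- The signature of a subgraph of the grid: to each cell it assigns the number of edges of that
cell which belong to the subgraph. -/
noncomputable def signature {m n : ℕ} (C : (grid m n).Subgraph) : Cell m n → ℕ :=
  fun c => (c.edges ∩ C.edgeSet).ncard

/-- The difference of two subgraphs: the set of all edges which belong to exactly one of them. -/
def difference {V : Type*} {G : SimpleGraph V} (C₁ C₂ : G.Subgraph) : Set (Sym2 V) :=
  symmDiff C₁.edgeSet C₂.edgeSet

end Slitherlink

/-! Extend by zero the indicators `a`, `b` of the cells enclosed by the two cycles and put `k = a -
b`, `l = a + b - 1`; at each cell exactly one of `k`, `l` vanishes. Equal signatures amount to `k *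
nbrSum l + l * nbrSum k = 0` at every cell of the grid, so there each function has zero neighbour
sum wherever it vanishes (`signPair_of_signature`). Let K be the support of `k`. An edge lies in
exactly one cycle when it separates a cell of K from one outside K, so the difference has D = Σ k² ·
nbrSum(l²) edges (`ncard_difference_eq`).

Colour the cells as a checkerboard. Adjacent pairs inside K are counted equally from both colours,
whence D = 2 D_odd + 4|K| - 8|K_odd|, where D_odd counts the edges from the odd cells of K.
Summation by parts gives 4 ∣ D_odd (`four_dvd_odd`), so D ≡ 4|K| mod 8 and it remains to show that
|K| is even.

Modulo two, `k²` is harmonic with zero boundary values, hence equals G(i + j) + G(i - j) with G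
symmetric about 0, m and n (`exists_wave`). Euclidean descent gives |K| ≡ (m + 1)(n + 1) G(m) G(n)
(`waveSum_eq`). When m and n are both even, pairing `l` with an integer harmonic function supported
on the wave relates the signs of G at 0, m, n and m + n (`sgn_corners`), which excludes G(m) = G(n)
= 1. -/

namespace Slitherlink

/-! ### Box sums and summation by parts -/

/-- The sum of the values of `f` at the four lattice neighbours of `(i, j)`. -/
def nbrSum (f : ℤ → ℤ → ℤ) (i j : ℤ) : ℤ :=
  f (i + 1) j + f (i - 1) j + f i (j + 1) + f i (j - 1)

/-- The sum of `f` over the lattice points of `[0, m] × [0, n]`. -/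
def boxSum (m n : ℕ) (f : ℤ → ℤ → ℤ) : ℤ :=
  ∑ i ∈ Finset.range (m + 1), ∑ j ∈ Finset.range (n + 1), f i j

/-- The lattice point `(i, j)` lies strictly inside `[0, m] × [0, n]`. -/
def Inner (m n : ℕ) (i j : ℤ) : Prop := (0 < i ∧ i < m) ∧ 0 < j ∧ j < n

lemma boxSum_congr {m n : ℕ} {f g : ℤ → ℤ → ℤ}
    (h : ∀ i j : ℤ, 0 ≤ i → i ≤ m → 0 ≤ j → j ≤ n → f i j = g i j) :
    boxSum m n f = boxSum m n g := by
  refine Finset.sum_congr rfl fun i hi => Finset.sum_congr rfl fun j hj => ?_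
  rw [Finset.mem_range] at hi hj
  exact h i j (by omega) (by omega) (by omega) (by omega)

lemma boxSum_add (m n : ℕ) (f g : ℤ → ℤ → ℤ) :
    boxSum m n (fun i j => f i j + g i j) = boxSum m n f + boxSum m n g := by
  simp only [boxSum, Finset.sum_add_distrib]

lemma boxSum_mul_left (m n : ℕ) (a : ℤ) (f : ℤ → ℤ → ℤ) :
    boxSum m n (fun i j => a * f i j) = a * boxSum m n f := by
  simp only [boxSum, Finset.mul_sum]

lemma dvd_boxSum {m n : ℕ} {a : ℤ} {f : ℤ → ℤ → ℤ} (h : ∀ i j, a ∣ f i j) :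
    a ∣ boxSum m n f :=
  Finset.dvd_sum fun _ _ => Finset.dvd_sum fun _ _ => h _ _

lemma boxSum_eq_zero {m n : ℕ} {f : ℤ → ℤ → ℤ}
    (h : ∀ i j : ℤ, 0 ≤ i → i ≤ m → 0 ≤ j → j ≤ n → f i j = 0) : boxSum m n f = 0 := by
  rw [boxSum_congr h]; simp [boxSum]

lemma sum_range_shift_pred (m : ℕ) (f : ℤ → ℤ) (h₀ : f (-1) = 0) (hm : f m = 0) :
    ∑ i ∈ Finset.range (m + 1), f ((i : ℤ) - 1) = ∑ i ∈ Finset.range (m + 1), f i := by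
  rw [Finset.sum_range_succ', Finset.sum_range_succ]
  simp [h₀, hm]

lemma sum_range_shift_succ (m : ℕ) (f : ℤ → ℤ) (h₀ : f 0 = 0) (hm : f (m + 1) = 0) :
    ∑ i ∈ Finset.range (m + 1), f ((i : ℤ) + 1) = ∑ i ∈ Finset.range (m + 1), f i := by
  have h := Finset.sum_range_succ (fun i : ℕ => f i) (m + 1)
  rw [Finset.sum_range_succ'] at h
  simpa [h₀, hm] using h

/-- The neighbour sum is self-adjoint. -/
lemma boxSum_mul_nbrSum {m n : ℕ} {f : ℤ → ℤ → ℤ} (hf : ∀ i j, ¬ Inner m n i j → f i j = 0)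
    (g : ℤ → ℤ → ℤ) :
    boxSum m n (fun i j => f i j * nbrSum g i j) =
      boxSum m n (fun i j => nbrSum f i j * g i j) := by
  have e₁ : boxSum m n (fun i j => f (i - 1) j * g i j) =
      boxSum m n (fun i j => f i j * g (i + 1) j) := by
    have := sum_range_shift_pred m
      (fun i => ∑ j ∈ Finset.range (n + 1), f i j * g (i + 1) j)
      (Finset.sum_eq_zero fun j _ => by rw [hf _ _ (by rintro ⟨h, -⟩; omega), zero_mul])
      (Finset.sum_eq_zero fun j _ => by rw [hf _ _ (by rintro ⟨h, -⟩; omega), zero_mul])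
    simpa [boxSum] using this
  have e₂ : boxSum m n (fun i j => f (i + 1) j * g i j) =
      boxSum m n (fun i j => f i j * g (i - 1) j) := by
    have := sum_range_shift_succ m
      (fun i => ∑ j ∈ Finset.range (n + 1), f i j * g (i - 1) j)
      (Finset.sum_eq_zero fun j _ => by rw [hf _ _ (by rintro ⟨h, -⟩; omega), zero_mul])
      (Finset.sum_eq_zero fun j _ => by rw [hf _ _ (by rintro ⟨h, -⟩; omega), zero_mul])
    simpa [boxSum] using this
  have e₃ : boxSum m n (fun i j => f i (j - 1) * g i j) =
      boxSum m n (fun i j => f i j * g i (j + 1)) := by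
    refine Finset.sum_congr rfl fun i _ => ?_
    have := sum_range_shift_pred n (fun j => f i j * g i (j + 1))
      (by rw [hf _ _ (by rintro ⟨-, h⟩; omega), zero_mul])
      (by rw [hf _ _ (by rintro ⟨-, h⟩; omega), zero_mul])
    simpa [boxSum] using this
  have e₄ : boxSum m n (fun i j => f i (j + 1) * g i j) =
      boxSum m n (fun i j => f i j * g i (j - 1)) := by
    refine Finset.sum_congr rfl fun i _ => ?_
    have := sum_range_shift_succ n (fun j => f i j * g i (j - 1))
      (by rw [hf _ _ (by rintro ⟨-, h⟩; omega), zero_mul])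
      (by rw [hf _ _ (by rintro ⟨-, h⟩; omega), zero_mul])
    simpa using this
  simp only [nbrSum, mul_add, add_mul, boxSum_add, e₁, e₂, e₃, e₄]
  ring

/-! ### The checkerboard colouring -/

/-- `1` at the points with odd coordinate sum, `0` at the others. -/
def oddMask (i j : ℤ) : ℤ := if Even (i + j) then 0 else 1

lemma oddMask_succ_left (i j : ℤ) : oddMask (i + 1) j = 1 - oddMask i j := by
  simp only [oddMask, add_right_comm i 1 j, Int.even_add_one]
  split_ifs <;> simp_all

lemma oddMask_pred_left (i j : ℤ) : oddMask (i - 1) j = 1 - oddMask i j := by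
  have := oddMask_succ_left (i - 1) j
  rw [sub_add_cancel] at this
  rw [this]; ring

lemma oddMask_succ_right (i j : ℤ) : oddMask i (j + 1) = 1 - oddMask i j := by
  have := oddMask_succ_left i j
  rwa [oddMask, show i + 1 + j = i + (j + 1) by ring] at this

lemma oddMask_pred_right (i j : ℤ) : oddMask i (j - 1) = 1 - oddMask i j := by
  have := oddMask_succ_right i (j - 1)
  rw [sub_add_cancel] at this
  rw [this]; ring

lemma nbrSum_oddMask_mul (f : ℤ → ℤ → ℤ) (i j : ℤ) :
    nbrSum (fun i j => oddMask i j * f i j) i j = (1 - oddMask i j) * nbrSum f i j := by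
  simp only [nbrSum, oddMask_succ_left, oddMask_pred_left, oddMask_succ_right, oddMask_pred_right]
  ring

lemma nbrSum_evenMask_mul (f : ℤ → ℤ → ℤ) (i j : ℤ) :
    nbrSum (fun i j => (1 - oddMask i j) * f i j) i j = oddMask i j * nbrSum f i j := by
  simp only [nbrSum, oddMask_succ_left, oddMask_pred_left, oddMask_succ_right, oddMask_pred_right]
  ring

/-! ### Sign pairs and the reduction modulo eight -/

/-- Two `{-1, 0, 1}`-valued functions on the lattice, exactly one of which vanishes at each point,
coming from the indicators `u`, `v` of two sets of cells with the same signature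
as `k = u - v` and `l = u + v - 1`. -/
structure SignPair (m n : ℕ) (k l : ℤ → ℤ → ℤ) : Prop where
  cases : ∀ i j, (k i j = 0 ∧ (l i j = 1 ∨ l i j = -1)) ∨ ((k i j = 1 ∨ k i j = -1) ∧ l i j = 0)
  outer : ∀ i j, ¬ Inner m n i j → k i j = 0 ∧ l i j = -1
  nbr_k : ∀ i j, Inner m n i j → k i j = 0 → nbrSum k i j = 0
  nbr_l : ∀ i j, k i j ≠ 0 → nbrSum l i j = 0

namespace SignPair

variable {m n : ℕ} {k l : ℤ → ℤ → ℤ}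

lemma sq_l (h : SignPair m n k l) (i j : ℤ) : l i j ^ 2 = 1 - k i j ^ 2 := by
  rcases h.cases i j with ⟨h₁, h₂ | h₂⟩ | ⟨h₁ | h₁, h₂⟩ <;> rw [h₁, h₂] <;> norm_num

/-- Replacing `k²` by `k² + k` and `l²` by `l² + l` does not change the sum, and makes both factors
even. The mask is needed for this: summation by parts then leaves the neighbour sum of `k` itself on
the other colour. -/
lemma four_dvd_odd (h : SignPair m n k l) :
    4 ∣ boxSum m n (fun i j => oddMask i j * k i j ^ 2 * nbrSum (fun i j => l i j ^ 2) i j) := by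
  have e₁ : boxSum m n (fun i j => oddMask i j * k i j *
      nbrSum (fun i j => l i j ^ 2 + l i j) i j) = 0 := by
    rw [boxSum_mul_nbrSum fun i j hij => by rw [(h.outer i j hij).1, mul_zero]]
    refine boxSum_eq_zero fun i j _ _ _ _ => ?_
    rw [nbrSum_oddMask_mul]
    by_cases hij : Inner m n i j
    · rcases h.cases i j with ⟨h₁, -⟩ | ⟨-, h₂⟩
      · rw [h.nbr_k i j hij h₁]; ring
      · rw [h₂]; ring
    -- Outside the box nothing is known about `nbrSum k`, but `l = -1` is a root of `x² + x`.
    · rw [(h.outer i j hij).2]; ring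
  have e₂ : boxSum m n (fun i j => oddMask i j * k i j ^ 2 * nbrSum (fun i j => l i j ^ 2) i j) =
      boxSum m n (fun i j => oddMask i j * (k i j ^ 2 + k i j) *
        nbrSum (fun i j => l i j ^ 2 + l i j) i j) := by
    rw [← add_zero (boxSum m n _), ← e₁, ← boxSum_add]
    refine boxSum_congr fun i j _ _ _ _ => ?_
    by_cases hk : k i j = 0
    · rw [hk]; ring
    · have : nbrSum (fun i j => l i j ^ 2 + l i j) i j =
          nbrSum (fun i j => l i j ^ 2) i j + nbrSum l i j := by simp only [nbrSum]; ring
      rw [this, h.nbr_l i j hk]; ring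
  rw [e₂]
  have hk : ∀ i j, 2 ∣ k i j ^ 2 + k i j := fun i j => by
    rcases h.cases i j with ⟨h₁, -⟩ | ⟨h₁ | h₁, -⟩ <;> rw [h₁] <;> norm_num
  have hl : ∀ i j, 2 ∣ l i j ^ 2 + l i j := fun i j => by
    rcases h.cases i j with ⟨-, h₂ | h₂⟩ | ⟨-, h₂⟩ <;> rw [h₂] <;> norm_num
  refine dvd_boxSum fun i j => ?_
  rw [show (4 : ℤ) = 2 * 2 by norm_num]
  exact mul_dvd_mul ((hk i j).mul_left _)
    (dvd_add (dvd_add (dvd_add (hl _ _) (hl _ _)) (hl _ _)) (hl _ _))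

/-- Modulo eight, the size of the difference is four times the number of cells enclosed by exactly
one of the two sets of edges. -/
lemma eight_dvd_sub (h : SignPair m n k l) :
    8 ∣ boxSum m n (fun i j => k i j ^ 2 * nbrSum (fun i j => l i j ^ 2) i j) -
      4 * boxSum m n (fun i j => k i j ^ 2) := by
  have hsupp : ∀ i j, ¬ Inner m n i j → (1 - 2 * oddMask i j) * k i j ^ 2 = 0 := fun i j hij => by
    rw [(h.outer i j hij).1]; ring
  -- The weight `1 - 2 * oddMask` changes sign between neighbours, so by self-adjointness this sum
  -- is its own negative.
  have e₀ : boxSum m n (fun i j => (1 - 2 * oddMask i j) * k i j ^ 2 *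
      nbrSum (fun i j => k i j ^ 2) i j) = 0 := by
    have e := boxSum_mul_nbrSum hsupp (fun i j => k i j ^ 2)
    have e' : boxSum m n (fun i j => nbrSum (fun i j => (1 - 2 * oddMask i j) * k i j ^ 2) i j *
        k i j ^ 2) = (-1) * boxSum m n (fun i j => (1 - 2 * oddMask i j) * k i j ^ 2 *
          nbrSum (fun i j => k i j ^ 2) i j) := by
      rw [← boxSum_mul_left]
      refine boxSum_congr fun i j _ _ _ _ => ?_
      simp only [nbrSum, oddMask_succ_left, oddMask_pred_left, oddMask_succ_right,
        oddMask_pred_right]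
      ring
    linarith
  have e₁ : boxSum m n (fun i j => k i j ^ 2 * nbrSum (fun i j => l i j ^ 2) i j) =
      4 * boxSum m n (fun i j => k i j ^ 2) +
      2 * boxSum m n (fun i j => oddMask i j * k i j ^ 2 * nbrSum (fun i j => l i j ^ 2) i j) +
      (-8) * boxSum m n (fun i j => oddMask i j * k i j ^ 2) := by
    -- Once the vanishing sum `e₀` is subtracted, the identity holds pointwise by `l² = 1 - k²`.
    suffices boxSum m n (fun i j => k i j ^ 2 * nbrSum (fun i j => l i j ^ 2) i j) =
        4 * boxSum m n (fun i j => k i j ^ 2) +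
        2 * boxSum m n (fun i j => oddMask i j * k i j ^ 2 * nbrSum (fun i j => l i j ^ 2) i j) +
        (-8) * boxSum m n (fun i j => oddMask i j * k i j ^ 2) +
        (-1) * boxSum m n (fun i j => (1 - 2 * oddMask i j) * k i j ^ 2 *
          nbrSum (fun i j => k i j ^ 2) i j) by rw [this, e₀]; ring
    simp only [← boxSum_mul_left, ← boxSum_add]
    refine boxSum_congr fun i j _ _ _ _ => ?_
    simp only [nbrSum, h.sq_l]
    ring
  obtain ⟨a, ha⟩ := h.four_dvd_odd
  rw [e₁, ha]
  exact ⟨a - boxSum m n (fun i j => oddMask i j * k i j ^ 2), by ring⟩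

/-- Modulo two, `k²` is congruent both to `k` and to `1 + l`; the first form serves where `k`
vanishes, the second where `l` does. -/
lemma two_dvd_nbrSum_sq (h : SignPair m n k l) (i j : ℤ) (hij : Inner m n i j) :
    2 ∣ nbrSum (fun i j => k i j ^ 2) i j := by
  have hk : ∀ i j, ∃ a, k i j ^ 2 = k i j + 2 * a := fun i j => by
    rcases h.cases i j with ⟨h₁, -⟩ | ⟨h₁ | h₁, -⟩
    · exact ⟨0, by rw [h₁]; norm_num⟩
    · exact ⟨0, by rw [h₁]; norm_num⟩
    · exact ⟨1, by rw [h₁]; norm_num⟩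
  have hl : ∀ i j, ∃ a, k i j ^ 2 = 1 + l i j + 2 * a := fun i j => by
    rcases h.cases i j with ⟨h₁, h₂ | h₂⟩ | ⟨h₁ | h₁, h₂⟩
    · exact ⟨-1, by rw [h₁, h₂]; norm_num⟩
    · exact ⟨0, by rw [h₁, h₂]; norm_num⟩
    · exact ⟨0, by rw [h₁, h₂]; norm_num⟩
    · exact ⟨0, by rw [h₁, h₂]; norm_num⟩
  by_cases h0 : k i j = 0
  · have := h.nbr_k i j hij h0
    obtain ⟨a, ha⟩ := hk (i + 1) j
    obtain ⟨b, hb⟩ := hk (i - 1) j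
    obtain ⟨c, hc⟩ := hk i (j + 1)
    obtain ⟨d, hd⟩ := hk i (j - 1)
    simp only [nbrSum] at this ⊢
    omega
  · have := h.nbr_l i j h0
    obtain ⟨a, ha⟩ := hl (i + 1) j
    obtain ⟨b, hb⟩ := hl (i - 1) j
    obtain ⟨c, hc⟩ := hl i (j + 1)
    obtain ⟨d, hd⟩ := hl i (j - 1)
    simp only [nbrSum] at this ⊢
    omega

end SignPair

/-! ### Symmetric sequences and the parity of a wave -/

/-- The sequence `G` is symmetric about `a`. -/
def SymmAbout (G : ℤ → ZMod 2) (a : ℤ) : Prop := ∀ t, G (a + t) = G (a - t)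

/-- Composing reflections gives reflections; this is what lets the pair `(m, n)` be reduced by
Euclid's algorithm. -/
lemma SymmAbout.sub {G : ℤ → ZMod 2} {a b : ℤ} (h₀ : SymmAbout G 0) (ha : SymmAbout G a)
    (hb : SymmAbout G b) : SymmAbout G (a - b) := fun t => by
  have e₁ := ha (b - t)
  have e₂ := hb (a - t)
  have e₃ := h₀ (b - a + t)
  rw [show a - b + t = a - (b - t) by ring, ← e₁, show a + (b - t) = b + (a - t) by ring, e₂,
    show b - (a - t) = 0 + (b - a + t) by ring, e₃]
  congr 1; ring

lemma SymmAbout.neg {G : ℤ → ZMod 2} (h₀ : SymmAbout G 0) (t : ℤ) : G (-t) = G t := by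
  simpa using (h₀ t).symm

/-- The parity of the number of points in `[0, m) × [0, n)` where the wave `G (i + j) + G (i - j)`
is nonzero. -/
def waveSum (G : ℤ → ZMod 2) (m n : ℕ) : ZMod 2 :=
  ∑ i ∈ Finset.range m, ∑ j ∈ Finset.range n, (G (i + j) + G (i - j))

lemma waveSum_comm {G : ℤ → ZMod 2} (h₀ : SymmAbout G 0) (m n : ℕ) :
    waveSum G m n = waveSum G n m := by
  rw [waveSum, Finset.sum_comm]
  refine Finset.sum_congr rfl fun i _ => Finset.sum_congr rfl fun j _ => ?_
  rw [add_comm (j : ℤ), ← h₀.neg (j - i), neg_sub]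

/-- Passing from `i` to `i + 1` shifts both sums by one place, so only end terms change; symmetry
about `0` and `n` folds `G (i + 1 - n)` to `G (n + (i + 1))`. -/
lemma wave_column {G : ℤ → ZMod 2} (h₀ : SymmAbout G 0) {n : ℕ} (hn : SymmAbout G n) (i : ℕ) :
    ∑ j ∈ Finset.range n, (G (i + j) + G (i - j)) = G (n + i) + G n + G i + G 0 := by
  induction i with
  | zero =>
    rw [Finset.sum_eq_zero]
    · simp only [Nat.cast_zero, add_zero, CharTwo.add_self_eq_zero, zero_add]
    · intro j _
      rw [Nat.cast_zero, h₀ j, CharTwo.add_self_eq_zero]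
  | succ i ih =>
    have e₁ := Finset.sum_range_sub (fun j : ℕ => G (i + j)) n
    have e₂ := Finset.sum_range_sub (fun j : ℕ => G (i + 1 - j)) n
    have e₃ := hn (-(i + 1))
    rw [← h₀.neg, show -((n : ℤ) + -(i + 1)) = i + 1 - n by ring,
      show (n : ℤ) - -(i + 1) = n + (i + 1) by ring] at e₃
    simp only [CharTwo.sub_eq_add, Finset.sum_add_distrib, Nat.cast_add, Nat.cast_one,
      Nat.cast_zero, add_zero, sub_zero, e₃, add_sub_add_right_eq_sub] at e₁ e₂ ih ⊢
    have e₄ : ∑ j ∈ Finset.range n, G (i + 1 + j) = ∑ j ∈ Finset.range n, G (i + (j + 1)) :=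
      Finset.sum_congr rfl fun j _ => by congr 1; ring
    rw [e₄]
    rw [add_comm (n : ℤ) i] at ih
    generalize ∑ j ∈ Finset.range n, G (i + (j + 1)) = a at *
    generalize ∑ j ∈ Finset.range n, G (i + j : ℤ) = b at *
    generalize ∑ j ∈ Finset.range n, G (i - j : ℤ) = c at *
    generalize ∑ j ∈ Finset.range n, G (i + 1 - j : ℤ) = d at *
    generalize G n = x at *
    generalize G 0 = x0 at *
    generalize G i = x1 at *
    generalize G (i + n) = x2 at *
    generalize G (n + (i + 1)) = x3 at *
    generalize G (i + 1) = x4 at *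
    clear * - e₁ e₂ ih
    revert a b c d x x0 x1 x2 x3 x4
    -- Only finitely many residues modulo two are left, so all assignments can be checked.
    decide

/-- Column `m` of the wave vanishes by symmetry about `m`; compare with `wave_column`. -/
lemma wave_add {G : ℤ → ZMod 2} (h₀ : SymmAbout G 0) (hG : G 0 = 0) {m n : ℕ}
    (hm : SymmAbout G m) (hn : SymmAbout G n) : G (m + n) = G m + G n := by
  have e := wave_column h₀ hn m
  rw [Finset.sum_eq_zero fun j _ => by rw [hm, CharTwo.add_self_eq_zero], hG, add_zero,
    add_comm (n : ℤ)] at e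
  generalize G (m + n) = a at *
  generalize G m = b at *
  generalize G n = c at *
  clear * - e
  revert a b c
  decide

lemma waveSum_square {H : ℤ → ZMod 2} (h₀ : SymmAbout H 0) {n : ℕ} (hn : SymmAbout H n) :
    waveSum H n n = (n + 1) * (H 0 + H n) := by
  have e₁ : ∑ i ∈ Finset.range n, H (n + i) = ∑ i ∈ Finset.range n, H (i + 1) := by
    rw [← Finset.sum_range_reflect (fun i : ℕ => H (i + 1)) n]
    refine Finset.sum_congr rfl fun i hi => ?_
    rw [Finset.mem_range] at hi
    rw [hn]
    congr 1
    omega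
  have e₂ := Finset.sum_range_sub (fun j : ℕ => H j) n
  simp only [waveSum, wave_column h₀ hn, Finset.sum_add_distrib, e₁, Finset.sum_const,
    Finset.card_range, nsmul_eq_mul]
  simp only [CharTwo.sub_eq_add, Finset.sum_add_distrib, Nat.cast_add, Nat.cast_one,
    Nat.cast_zero] at e₂
  linear_combination e₂

/-- Cut off an `n × n` square. On it the wave is that of the shifted sequence `G (m + t)`, which is
again symmetric about `0` and `n` but need not vanish at `0`. -/
lemma waveSum_add {G : ℤ → ZMod 2} (h₀ : SymmAbout G 0) (hG : G 0 = 0) {m n : ℕ}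
    (hm : SymmAbout G m) (hn : SymmAbout G n) :
    waveSum G (m + n) n = waveSum G m n + (n + 1) * G n := by
  have h₁ : SymmAbout (fun t => G (m + t)) 0 := fun t => by
    simpa [← sub_eq_add_neg] using hm t
  have h₂ : SymmAbout (fun t => G (m + t)) n := fun t => by
    have e₁ := hn (m + t)
    have e₂ := h₀ (n - (m + t))
    have e₃ := hm (n - t)
    simp only [zero_add, zero_sub] at e₂
    dsimp only
    rw [show (m : ℤ) + (n + t) = n + (m + t) by ring, e₁, e₂, e₃]
    congr 1; ring
  have e := waveSum_square h₁ h₂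
  rw [add_zero, wave_add h₀ hG hm hn, ← add_assoc, CharTwo.add_self_eq_zero, zero_add] at e
  rw [← e, waveSum, Finset.sum_range_add, waveSum, waveSum]
  simp only [Nat.cast_add, add_assoc, add_sub_assoc]

/-- Subtractive Euclidean algorithm on `(m, n)`. The second identity is carried along because the
induction step for the first one needs it. -/
lemma waveSum_eq {G : ℤ → ZMod 2} (h₀ : SymmAbout G 0) (hG : G 0 = 0) (N : ℕ) :
    ∀ m n : ℕ, m + n ≤ N → SymmAbout G m → SymmAbout G n →
      waveSum G m n = (m + 1) * (n + 1) * (G m * G n) ∧ m * G n = n * G m := by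
  induction N with
  | zero =>
    intro m n h _ _
    obtain ⟨rfl, rfl⟩ : m = 0 ∧ n = 0 := by omega
    simp [waveSum, hG]
  | succ N ih =>
    have key : ∀ m n : ℕ, n ≤ m → m + n ≤ N + 1 → SymmAbout G m → SymmAbout G n →
        waveSum G m n = (m + 1) * (n + 1) * (G m * G n) ∧ m * G n = n * G m := by
      intro m n hnm h hm hn
      rcases n.eq_zero_or_pos with rfl | hpos
      · simp [waveSum, hG]
      obtain ⟨d, rfl⟩ := Nat.exists_eq_add_of_le' hnm
      have hd : SymmAbout G d := by simpa using h₀.sub hm hn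
      obtain ⟨i₁, i₂⟩ := ih d n (by omega) hd hn
      have e := wave_add h₀ hG hd hn
      push_cast
      rw [waveSum_add h₀ hG hd hn, i₁, e]
      generalize G n = x at *
      generalize G d = y at *
      generalize (n : ZMod 2) = a at *
      generalize (d : ZMod 2) = b at *
      clear * - i₂
      revert a b x y
      decide
    intro m n h hm hn
    rcases le_total n m with hnm | hnm
    · exact key m n hnm h hm hn
    · obtain ⟨h₁, h₂⟩ := key n m hnm (by omega) hn hm
      exact ⟨by rw [waveSum_comm h₀, h₁]; ring, h₂.symm⟩

/-! ### Plane wave decomposition modulo two -/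

/-- Steps of a symmetric sequence can be prescribed. -/
lemma exists_symm_steps (h : ℤ → ZMod 2) (h0 : h 0 = 0) (hs : ∀ t, h (-t) = h t) :
    ∃ G : ℤ → ZMod 2, SymmAbout G 0 ∧ G 0 = 0 ∧ G 1 = 0 ∧ ∀ t, G (t + 1) + G (t - 1) = h t := by
  -- `A k` is the pair of values of the sequence at `k` and `k + 1`.
  let A : ℕ → ZMod 2 × ZMod 2 := fun k =>
    Nat.rec (0, 0) (fun k p => (p.2, p.1 + h (k + 1))) k
  have hA : ∀ k : ℕ, (A (k + 2)).1 + (A k).1 = h (k + 1) := fun k => by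
    change (A k).1 + h (k + 1) + (A k).1 = h (k + 1)
    rw [add_comm, ← add_assoc, CharTwo.add_self_eq_zero, zero_add]
  refine ⟨fun t => (A t.natAbs).1, fun t => by simp, rfl, rfl, fun t => ?_⟩
  obtain ⟨k, rfl | rfl⟩ := t.eq_nat_or_neg
  · rcases k with _ | k
    · simpa [h0] using CharTwo.add_self_eq_zero (A 1).1
    · have := hA k
      dsimp only
      rw [show ((k + 1 : ℕ) + 1 : ℤ).natAbs = k + 2 by omega,
        show ((k + 1 : ℕ) - 1 : ℤ).natAbs = k by omega, this]
      push_cast; rfl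
  · rcases k with _ | k
    · simpa [h0] using CharTwo.add_self_eq_zero (A 1).1
    · have := hA k
      dsimp only
      rw [show (-(k + 1 : ℕ) + 1 : ℤ).natAbs = k by omega,
        show (-(k + 1 : ℕ) - 1 : ℤ).natAbs = k + 2 by omega, add_comm, this, hs]
      push_cast; rfl

/-- The distance from `t` to the nearest multiple of `2 * n`. -/
def fold (n t : ℤ) : ℤ := if t % (2 * n) ≤ n then t % (2 * n) else 2 * n - t % (2 * n)

lemma fold_eq_self {n t : ℤ} (h₀ : 0 ≤ t) (h : t ≤ n) : fold n t = t := by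
  rcases h₀.eq_or_lt with rfl | h₀
  · rw [fold, Int.zero_emod, if_pos h]
  rw [fold, Int.emod_eq_of_lt (by omega) (by omega), if_pos h]

lemma fold_spec {n : ℤ} (hn : 0 < n) (t : ℤ) : 0 ≤ fold n t ∧ fold n t ≤ n ∧
    ∃ q : ℤ, t = 2 * n * q + fold n t ∨ t = 2 * n * q - fold n t := by
  have h₁ := Int.emod_nonneg t (show 2 * n ≠ 0 by omega)
  have h₂ := Int.emod_lt_of_pos t (show 0 < 2 * n by omega)
  have h₃ := Int.mul_ediv_add_emod t (2 * n)
  unfold fold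
  split_ifs with h
  · exact ⟨h₁, h, _, Or.inl h₃.symm⟩
  · exact ⟨by omega, by omega, t / (2 * n) + 1, Or.inr (by linarith)⟩

lemma fold_eq {n t f q : ℤ} (h₀ : 0 ≤ f) (h : f ≤ n)
    (ht : t = 2 * n * q + f ∨ t = 2 * n * q - f) : fold n t = f := by
  rcases h₀.eq_or_lt with rfl | h₀
  · have : t % (2 * n) = 0 := by
      rcases ht with rfl | rfl <;> simp
    rw [fold, this, if_pos h]
  rcases ht with rfl | rfl
  · rw [fold, Int.mul_add_emod_self_left, Int.emod_eq_of_lt (by omega) (by omega), if_pos h]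
  · have : (2 * n * q - f) % (2 * n) = 2 * n - f := by
      rw [show 2 * n * q - f = 2 * n * (q - 1) + (2 * n - f) by ring, Int.mul_add_emod_self_left,
        Int.emod_eq_of_lt (by omega) (by omega)]
    rw [fold, this]
    split_ifs <;> omega

lemma fold_neg {n : ℤ} (hn : 0 < n) (t : ℤ) : fold n (-t) = fold n t := by
  obtain ⟨h₁, h₂, q, h | h⟩ := fold_spec hn t
  · exact fold_eq (q := -q) h₁ h₂ (Or.inr (by linarith))
  · exact fold_eq (q := -q) h₁ h₂ (Or.inl (by linarith))

lemma fold_add_eq_sub {n : ℤ} (hn : 0 < n) (t : ℤ) : fold n (n + t) = fold n (n - t) := by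
  obtain ⟨h₁, h₂, q, h | h⟩ := fold_spec hn (n - t)
  · exact fold_eq (q := 1 - q) h₁ h₂ (Or.inr (by linarith))
  · exact fold_eq (q := 1 - q) h₁ h₂ (Or.inl (by linarith))

/-- Away from the mirrors, folding at most swaps the two neighbours; at a mirror it identifies them,
and they cancel modulo two. -/
lemma fold_steps {n : ℤ} (hn : 0 < n) (f : ℤ → ZMod 2) (t : ℤ) :
    (0 < fold n t ∧ fold n t < n ∧
      f (fold n (t + 1)) + f (fold n (t - 1)) = f (fold n t + 1) + f (fold n t - 1)) ∨
    ((fold n t = 0 ∨ fold n t = n) ∧ f (fold n (t + 1)) + f (fold n (t - 1)) = 0) := by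
  obtain ⟨h₁, h₂, q, h⟩ := fold_spec hn t
  generalize fold n t = r at *
  rcases h₁.eq_or_lt with rfl | h₁
  · have e₁ : fold n (t + 1) = 1 := fold_eq (q := q) (by omega) (by omega) (Or.inl (by omega))
    have e₂ : fold n (t - 1) = 1 := fold_eq (q := q) (by omega) (by omega) (Or.inr (by omega))
    exact Or.inr ⟨Or.inl rfl, by rw [e₁, e₂, CharTwo.add_self_eq_zero]⟩
  rcases h₂.eq_or_lt with rfl | h₂
  · rcases h with h | h
    · have e₁ : fold r (t + 1) = r - 1 :=
        fold_eq (q := q + 1) (by omega) (by omega) (Or.inr (by linarith))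
      have e₂ : fold r (t - 1) = r - 1 :=
        fold_eq (q := q) (by omega) (by omega) (Or.inl (by omega))
      exact Or.inr ⟨Or.inr rfl, by rw [e₁, e₂, CharTwo.add_self_eq_zero]⟩
    · have e₁ : fold r (t + 1) = r - 1 :=
        fold_eq (q := q) (by omega) (by omega) (Or.inr (by linarith))
      have e₂ : fold r (t - 1) = r - 1 :=
        fold_eq (q := q - 1) (by omega) (by omega) (Or.inl (by linarith))
      exact Or.inr ⟨Or.inr rfl, by rw [e₁, e₂, CharTwo.add_self_eq_zero]⟩
  · refine Or.inl ⟨h₁, h₂, ?_⟩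
    rcases h with h | h
    · rw [fold_eq (f := r + 1) (q := q) (by omega) (by omega) (Or.inl (by omega)),
        fold_eq (f := r - 1) (q := q) (by omega) (by omega) (Or.inl (by omega))]
    · rw [fold_eq (f := r - 1) (q := q) (by omega) (by omega) (Or.inr (by omega)),
        fold_eq (f := r + 1) (q := q) (by omega) (by omega) (Or.inr (by omega)), add_comm]

/-- A harmonic function modulo two on a box which vanishes on the boundary is a superposition of
two plane waves. -/
lemma exists_wave {m n : ℕ} (hn : 0 < n) (w : ℤ → ℤ → ZMod 2)
    (hw : ∀ i j, ¬ Inner m n i j → w i j = 0)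
    (harm : ∀ i j, Inner m n i j → w (i + 1) j + w (i - 1) j + w i (j + 1) + w i (j - 1) = 0) :
    ∃ G : ℤ → ZMod 2, SymmAbout G 0 ∧ G 0 = 0 ∧ SymmAbout G m ∧ SymmAbout G n ∧
      ∀ i j : ℤ, 0 ≤ i → i ≤ m → 0 ≤ j → j ≤ n → w i j = G (i + j) + G (i - j) := by
  have hn' : (0 : ℤ) < n := by omega
  have hbd : ∀ i j : ℤ, j = 0 ∨ j = n → w i j = 0 := fun i j h =>
    hw i j fun ⟨_, h'⟩ => by omega
  -- Column `1`, extended by reflection in `0` and `n`, prescribes the steps of `G`; column `0` is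
  -- zero. The other columns follow from the recurrence `hrec`.
  obtain ⟨G, h₀, hG, -, hst⟩ := exists_symm_steps (fun t => w 1 (fold n t))
    (hbd _ _ (Or.inl (fold_eq_self le_rfl (by omega))))
    fun t => by rw [fold_neg hn']
  have hrec : ∀ i t : ℤ, 0 < i → i < m →
      w (i + 1) (fold n t) = w (i - 1) (fold n t) + (w i (fold n (t + 1)) + w i (fold n (t - 1))) := by
    intro i t hi hi'
    rcases fold_steps hn' (w i) t with ⟨a, b, c⟩ | ⟨a, b⟩
    · have := harm i (fold n t) ⟨⟨hi, hi'⟩, a, b⟩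
      rw [c, ← CharTwo.add_eq_zero, ← this]
      ring
    · rw [b, hbd _ _ a, hbd _ _ a, add_zero]
  have wave : ∀ i : ℕ, (i ≤ m → ∀ t : ℤ, w i (fold n t) = G (i + t) + G (i - t)) ∧
      (i + 1 ≤ m → ∀ t : ℤ, w (i + 1) (fold n t) = G (i + 1 + t) + G (i + 1 - t)) := by
    intro i
    induction i with
    | zero =>
      refine ⟨fun _ t => ?_, fun _ t => ?_⟩
      · rw [hw _ _ fun ⟨h, _⟩ => by simp at h, Nat.cast_zero, h₀ t, CharTwo.add_self_eq_zero]
      · rw [Nat.cast_zero, zero_add, ← hst t, ← h₀.neg (t - 1), neg_sub, add_comm t]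
    | succ i ih =>
      refine ⟨fun h t => by simpa using ih.2 h t, fun h t => ?_⟩
      have e := hrec (i + 1) t (by omega) (by omega)
      have i₁ := ih.1 (by omega)
      have i₂ := ih.2 (by omega)
      rw [i₂, i₂, add_sub_cancel_right, i₁] at e
      push_cast
      rw [e]
      rw [show (i : ℤ) + 1 + (t - 1) = i + t by ring, show (i : ℤ) + 1 - (t + 1) = i - t by ring,
        show (i : ℤ) + 1 + 1 + t = i + 1 + (t + 1) by ring,
        show (i : ℤ) + 1 + 1 - t = i + 1 - (t - 1) by ring]
      linear_combination CharTwo.add_self_eq_zero (G (i + t)) + CharTwo.add_self_eq_zero (G (i - t))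
  have hmm : SymmAbout G m := fun t => by
    have := (wave m).1 le_rfl t
    rw [hw _ _ fun ⟨h, _⟩ => by omega] at this
    exact CharTwo.add_eq_zero.1 this.symm
  refine ⟨G, h₀, hG, hmm, ?_, ?_⟩
  -- The steps of `G` are symmetric about `n`, and the step at `n` is zero because `w 1 n = 0`;
  -- these give the two starting cases.
  · have step : ∀ k : ℕ, G (n + k) = G (n - k) ∧ G (n + (k + 1)) = G (n - (k + 1)) := by
      intro k
      induction k with
      | zero =>
        have := hst n
        rw [hbd _ _ (Or.inr (fold_eq_self hn'.le le_rfl))] at this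
        simpa using CharTwo.add_eq_zero.1 this
      | succ k ih =>
        refine ⟨by simpa using ih.2, ?_⟩
        have e₁ := hst (n + (k + 1))
        have e₂ := hst (n - (k + 1))
        rw [fold_add_eq_sub hn', ← e₂] at e₁
        push_cast
        rw [show (n : ℤ) + (k + 1) - 1 = n + k by ring, ih.1,
          show (n : ℤ) - (k + 1) + 1 = n - k by ring, add_comm] at e₁
        have := add_left_cancel e₁
        rw [← add_assoc, this]
        congr 1; ring
    intro t
    obtain ⟨k, rfl | rfl⟩ := t.eq_nat_or_neg
    · exact (step k).1
    · rw [sub_neg_eq_add, ← sub_eq_add_neg]; exact (step k).1.symm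
  · intro i j hi hi' hj hj'
    have := (wave i.toNat).1 (by omega) j
    rwa [Int.toNat_of_nonneg hi, fold_eq_self hj hj'] at this

/-! ### The integer standing wave -/

lemma sum_range_two_mul (g : ℕ → ℤ) (M : ℕ) :
    ∑ i ∈ Finset.range (2 * M), g i = ∑ a ∈ Finset.range M, (g (2 * a) + g (2 * a + 1)) := by
  induction M with
  | zero => simp
  | succ M ih =>
    rw [show 2 * (M + 1) = 2 * M + 1 + 1 by ring, Finset.sum_range_succ, Finset.sum_range_succ,
      Finset.sum_range_succ, ih, add_assoc]

/-- The sign of a sequence of residues modulo two. -/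
def sgn (G : ℤ → ZMod 2) (t : ℤ) : ℤ := if G t = 0 then 1 else -1

/-- An integer harmonic function which is nonzero where the wave `G (i + j) + G (i - j)` is. -/
def standing (G : ℤ → ZMod 2) (i j : ℤ) : ℤ :=
  (1 - 2 * oddMask i 0) * (sgn G (i - j) - sgn G (i + j))

lemma nbrSum_standing (G : ℤ → ZMod 2) (i j : ℤ) : nbrSum (standing G) i j = 0 := by
  simp only [nbrSum, standing, oddMask_succ_left, oddMask_pred_left]
  rw [show i + 1 - j = i - j + 1 by ring, show i + 1 + j = i + j + 1 by ring,
    show i - 1 - j = i - j - 1 by ring, show i - 1 + j = i + j - 1 by ring,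
    show i - (j + 1) = i - j - 1 by ring, show i + (j + 1) = i + j + 1 by ring,
    show i - (j - 1) = i - j + 1 by ring, show i + (j - 1) = i + j - 1 by ring]
  ring

lemma sgn_congr {G : ℤ → ZMod 2} {s t : ℤ} (h : G s = G t) : sgn G s = sgn G t := by
  rw [sgn, sgn, h]

lemma standing_eq_zero {G : ℤ → ZMod 2} {i j : ℤ} (h : G (i - j) = G (i + j)) :
    standing G i j = 0 := by
  rw [standing, sgn_congr h, sub_self, mul_zero]

lemma oddMask_eq_zero {i j : ℤ} (h : Even (i + j)) : oddMask i j = 0 := if_pos h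

lemma oddMask_eq_one {i j : ℤ} (h : Odd (i + j)) : oddMask i j = 1 :=
  if_neg (Int.not_even_iff_odd.2 h)

namespace SignPair

variable {m n : ℕ} {k l : ℤ → ℤ → ℤ}

-- Pair the even part of the standing wave with `nbrSum l`. The pairing is zero, since the wave
-- vanishes where `k` does and `nbrSum l` vanishes elsewhere. By parts, harmonicity kills every term
-- inside the box; outside, `l` agrees with the constant `-1`, and that constant gives minus four
-- times the sum.
open Classical in
lemma boxSum_standing (h : SignPair m n k l) {G : ℤ → ZMod 2} (h₀ : SymmAbout G 0)
    (hm : SymmAbout G m) (hn : SymmAbout G n)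
    (hw : ∀ i j : ℤ, 0 ≤ i → i ≤ m → 0 ≤ j → j ≤ n →
      ((k i j ^ 2 : ℤ) : ZMod 2) = G (i + j) + G (i - j)) :
    boxSum m n (fun i j => (1 - oddMask i j) * standing G i j) = 0 := by
  -- Summation by parts needs support inside the box. Truncation changes nothing on the closed box,
  -- as symmetry about `0`, `m`, `n` makes the wave vanish on its sides.
  set P : ℤ → ℤ → ℤ := fun i j => if Inner m n i j then standing G i j else 0 with hP
  have hPs : ∀ i j : ℤ, 0 ≤ i → i ≤ m → 0 ≤ j → j ≤ n → P i j = standing G i j := by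
    intro i j a b c d
    simp only [hP]
    split_ifs with hij
    · rfl
    refine (standing_eq_zero ?_).symm
    obtain rfl | rfl | rfl | rfl : i = 0 ∨ i = m ∨ j = 0 ∨ j = n := by
      by_contra hh
      exact hij ⟨⟨by omega, by omega⟩, by omega, by omega⟩
    · exact (h₀ j).symm
    · exact (hm j).symm
    · rw [sub_zero, add_zero]
    · rw [← h₀.neg, neg_sub, ← hn, add_comm]
  have hPn : ∀ i j, Inner m n i j → nbrSum P i j = 0 := by
    rintro i j ⟨⟨a, b⟩, c, d⟩
    rw [← nbrSum_standing G i j]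
    simp only [nbrSum]
    rw [hPs, hPs, hPs, hPs] <;> omega
  have hf : ∀ i j, ¬ Inner m n i j → (1 - oddMask i j) * P i j = 0 := fun i j hij => by
    simp only [hP, if_neg hij, mul_zero]
  have e₁ : boxSum m n (fun i j => (1 - oddMask i j) * P i j * nbrSum l i j) = 0 := by
    refine boxSum_eq_zero fun i j a b c d => ?_
    by_cases hk : k i j = 0
    · have := hw i j a b c d
      rw [hk] at this
      rw [hPs i j a b c d, standing_eq_zero]
      · ring
      · exact (CharTwo.add_eq_zero.1 (by simpa using this.symm)).symm
    · rw [h.nbr_l i j hk, mul_zero]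
  have e₂ := boxSum_mul_nbrSum hf (fun _ _ => -1)
  rw [boxSum_mul_nbrSum hf] at e₁
  have e₃ : boxSum m n (fun i j => nbrSum (fun i j => (1 - oddMask i j) * P i j) i j * l i j) =
      boxSum m n (fun i j => nbrSum (fun i j => (1 - oddMask i j) * P i j) i j * -1) := by
    refine boxSum_congr fun i j _ _ _ _ => ?_
    by_cases hij : Inner m n i j
    · rw [nbrSum_evenMask_mul, hPn i j hij]; ring
    · rw [(h.outer i j hij).2]
  rw [← e₃, e₁] at e₂
  have e₄ : boxSum m n (fun i j => (1 - oddMask i j) * P i j * nbrSum (fun _ _ => -1) i j) =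
      (-4) * boxSum m n (fun i j => (1 - oddMask i j) * P i j) := by
    rw [← boxSum_mul_left]
    refine boxSum_congr fun i j _ _ _ _ => ?_
    simp only [nbrSum]; ring
  rw [e₄] at e₂
  rw [boxSum_congr (g := fun i j => (1 - oddMask i j) * P i j)]
  · omega
  · intro i j a b c d
    rw [hPs i j a b c d]

end SignPair

/-- Columns can be paired as `(2a, 2a + 1)` or as `(2a + 1, 2a + 2)`, since the first and last are
zero. Each pair telescopes in `b`, and the sum of the two resulting relations telescopes in `a`. -/
lemma sgn_corners {M N : ℕ} {G : ℤ → ZMod 2} (h₀ : SymmAbout G 0)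
    (hm : SymmAbout G (2 * M)) (hn : SymmAbout G (2 * N))
    (hS : boxSum (2 * M) (2 * N) (fun i j => (1 - oddMask i j) * standing G i j) = 0) :
    sgn G (2 * M) + sgn G (2 * N) = sgn G 0 + sgn G (2 * M + 2 * N) := by
  set f : ℤ → ℤ → ℤ := fun i j => (1 - oddMask i j) * standing G i j with hf
  have even_even : ∀ a b : ℤ, f (2 * a) (2 * b) =
      sgn G (2 * a - 2 * b) - sgn G (2 * a + 2 * b) := fun a b => by
    simp only [hf, standing]
    rw [oddMask_eq_zero ⟨a + b, by ring⟩, oddMask_eq_zero ⟨a, by ring⟩]; ring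
  have odd_odd : ∀ a b : ℤ, f (2 * a + 1) (2 * b + 1) =
      sgn G (2 * a + 2 * b + 2) - sgn G (2 * a - 2 * b) := fun a b => by
    simp only [hf, standing]
    rw [oddMask_eq_zero ⟨a + b + 1, by ring⟩, oddMask_eq_one ⟨a, by ring⟩,
      show 2 * a + 1 - (2 * b + 1) = 2 * a - 2 * b by ring,
      show 2 * a + 1 + (2 * b + 1) = 2 * a + 2 * b + 2 by ring]; ring
  have even_odd : ∀ a b : ℤ, f (2 * a) (2 * b + 1) = 0 := fun a b => by
    simp only [hf]
    rw [oddMask_eq_one ⟨a + b, by ring⟩]; ring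
  have odd_even : ∀ a b : ℤ, f (2 * a + 1) (2 * b) = 0 := fun a b => by
    simp only [hf]
    rw [oddMask_eq_one ⟨a + b, by ring⟩]; ring
  have bot : ∀ j : ℤ, f 0 j = 0 := fun j => by
    simp only [hf]; rw [standing_eq_zero (h₀ j).symm, mul_zero]
  have top : ∀ j : ℤ, f (2 * M) j = 0 := fun j => by
    simp only [hf]; rw [standing_eq_zero (hm j).symm, mul_zero]
  have right : ∀ i : ℤ, f i (2 * N) = 0 := fun i => by
    simp only [hf]
    rw [standing_eq_zero, mul_zero]
    rw [← h₀.neg, neg_sub, ← hn, add_comm]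
  have col : ∀ i : ℤ, ∑ j ∈ Finset.range (2 * N + 1), f i j =
      ∑ b ∈ Finset.range N, (f i (2 * b) + f i (2 * b + 1)) := fun i => by
    rw [Finset.sum_range_succ, sum_range_two_mul]
    push_cast
    rw [right, add_zero]
  have ev : ∀ a : ℤ, ∑ j ∈ Finset.range (2 * N + 1), f (2 * a) j =
      ∑ b ∈ Finset.range N, (sgn G (2 * a - 2 * b) - sgn G (2 * a + 2 * b)) := fun a => by
    simp only [col, even_even, even_odd, add_zero]
  have od : ∀ a : ℤ, ∑ j ∈ Finset.range (2 * N + 1), f (2 * a + 1) j =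
      ∑ b ∈ Finset.range N, (sgn G (2 * a + 2 * b + 2) - sgn G (2 * a - 2 * b)) := fun a => by
    simp only [col, odd_even, odd_odd, zero_add]
  have s₁ : ∑ a ∈ Finset.range M, (sgn G (2 * a + 2 * N) - sgn G (2 * a)) = 0 := by
    rw [← hS, boxSum, Finset.sum_range_succ, sum_range_two_mul]
    push_cast
    simp only [top, Finset.sum_const_zero, add_zero]
    refine Finset.sum_congr rfl fun a _ => ?_
    rw [ev, od, ← Finset.sum_add_distrib]
    have := Finset.sum_range_sub (fun b : ℕ => sgn G (2 * a + 2 * b)) N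
    simp only [Nat.cast_zero, mul_zero, add_zero] at this
    rw [← this]
    refine Finset.sum_congr rfl fun b _ => ?_
    push_cast
    rw [show 2 * (a : ℤ) + 2 * (b + 1) = 2 * a + 2 * b + 2 by ring]
    ring
  have s₂ : ∑ a ∈ Finset.range M, (sgn G (2 * (a + 1)) - sgn G (2 * (a + 1) + 2 * N)) = 0 := by
    rw [← hS, boxSum, Finset.sum_range_succ', sum_range_two_mul]
    push_cast
    simp only [bot, Finset.sum_const_zero, add_zero]
    refine Finset.sum_congr rfl fun a _ => ?_
    rw [show 2 * (a : ℤ) + 1 + 1 = 2 * (a + 1) by ring, ev, od, ← Finset.sum_add_distrib]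
    have := Finset.sum_range_sub' (fun b : ℕ => sgn G (2 * (a + 1) - 2 * b)) N
    simp only [Nat.cast_zero, mul_zero, sub_zero] at this
    have e := hn (2 * (a + 1))
    rw [← h₀.neg (_ - _), neg_sub] at e
    rw [add_comm (2 * ((a : ℤ) + 1)), sgn_congr e, ← this]
    refine Finset.sum_congr rfl fun b _ => ?_
    push_cast
    rw [show 2 * ((a : ℤ) + 1) - 2 * (b + 1) = 2 * a - 2 * b by ring,
      show 2 * ((a : ℤ) + 1) + 2 * b = 2 * a + 2 * b + 2 by ring]
    ring
  have t₁ := Finset.sum_range_sub (fun a : ℕ => sgn G (2 * a)) M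
  have t₂ := Finset.sum_range_sub (fun a : ℕ => sgn G (2 * a + 2 * N)) M
  simp only [Finset.sum_sub_distrib] at s₁ s₂ t₁ t₂
  push_cast at t₁ t₂
  simp only [zero_add] at t₁ t₂
  linarith

/-! ### Evenness of the support of `k` -/

namespace SignPair

variable {m n : ℕ} {k l : ℤ → ℤ → ℤ}

lemma two_dvd_boxSum_sq (h : SignPair m n k l) (hn : 0 < n) :
    2 ∣ boxSum m n (fun i j => k i j ^ 2) := by
  obtain ⟨G, h₀, hG, hGm, hGn, hw⟩ := exists_wave hn
    (fun i j => ((k i j ^ 2 : ℤ) : ZMod 2))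
    (fun i j hij => by simp [(h.outer i j hij).1])
    (fun i j hij => by
      have := (ZMod.intCast_zmod_eq_zero_iff_dvd _ 2).2 (h.two_dvd_nbrSum_sq i j hij)
      simpa [nbrSum] using this)
  have e : ((boxSum m n (fun i j => k i j ^ 2) : ℤ) : ZMod 2) = waveSum G m n := by
    -- `boxSum` includes the lines `i = m` and `j = n`, which `waveSum` omits; `k` is zero on them.
    rw [boxSum, Finset.sum_range_succ]
    rw [Finset.sum_eq_zero (s := Finset.range (n + 1)) (f := fun j => k (m : ℤ) j ^ 2), add_zero,
      Int.cast_sum]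
    · refine Finset.sum_congr rfl fun i hi => ?_
      rw [Finset.sum_range_succ, (h.outer i n fun hh => by have := hh.2.2; omega).1,
        zero_pow two_ne_zero, add_zero, Int.cast_sum]
      refine Finset.sum_congr rfl fun j hj => ?_
      rw [Finset.mem_range] at hi hj
      exact hw i j (by omega) (by omega) (by omega) (by omega)
    · intro j _
      rw [(h.outer m j fun hh => by have := hh.1.2; omega).1, zero_pow two_ne_zero]
  refine (ZMod.intCast_zmod_eq_zero_iff_dvd _ 2).1 (e.trans ?_)
  rw [(waveSum_eq h₀ hG _ m n le_rfl hGm hGn).1]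
  rcases m.even_or_odd' with ⟨M, rfl | rfl⟩
  swap
  · push_cast
    rw [show (2 : ZMod 2) = 0 from rfl, zero_mul, zero_add, CharTwo.add_self_eq_zero]
    ring
  rcases n.even_or_odd' with ⟨N, rfl | rfl⟩
  swap
  · push_cast
    rw [show (2 : ZMod 2) = 0 from rfl, zero_mul, zero_mul, zero_add, CharTwo.add_self_eq_zero]
    ring
  have hS := h.boxSum_standing h₀ hGm hGn hw
  push_cast at hGm hGn ⊢
  have c := sgn_corners h₀ hGm hGn hS
  -- If both values were `1`, then `c` would read `-2 = 1 ± 1`.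
  have hz : G (2 * M) * G (2 * N) = 0 := by
    simp only [sgn, hG, if_true] at c
    by_contra hne
    rw [if_neg (left_ne_zero_of_mul hne), if_neg (right_ne_zero_of_mul hne)] at c
    split_ifs at c <;> omega
  rw [hz, mul_zero]

lemma eight_dvd (h : SignPair m n k l) (hn : 0 < n) :
    8 ∣ boxSum m n (fun i j => k i j ^ 2 * nbrSum (fun i j => l i j ^ 2) i j) := by
  obtain ⟨a, ha⟩ := h.two_dvd_boxSum_sq hn
  have := h.eight_dvd_sub
  omega

end SignPair

/-! ### Edges in integer coordinates -/

section Edges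

variable {m n : ℕ}

/-- `e` is the unit segment from `(i - 1, j)` to `(i, j)`. -/
def HorizAt (e : Sym2 (Fin m × Fin n)) (i j : ℤ) : Prop :=
  ∃ p q : Fin m × Fin n, e = s(p, q) ∧ (p.1 : ℤ) + 1 = i ∧ (q.1 : ℤ) = i ∧ (p.2 : ℤ) = j ∧
    (q.2 : ℤ) = j

/-- `e` is the unit segment from `(i, j - 1)` to `(i, j)`. -/
def VertAt (e : Sym2 (Fin m × Fin n)) (i j : ℤ) : Prop :=
  ∃ p q : Fin m × Fin n, e = s(p, q) ∧ (p.1 : ℤ) = i ∧ (q.1 : ℤ) = i ∧ (p.2 : ℤ) + 1 = j ∧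
    (q.2 : ℤ) = j

lemma vertex_ext {p q : Fin m × Fin n} (h₁ : (p.1 : ℤ) = q.1) (h₂ : (p.2 : ℤ) = q.2) : p = q :=
  Prod.ext (Fin.ext (by omega)) (Fin.ext (by omega))

lemma HorizAt.unique {e e' : Sym2 (Fin m × Fin n)} {i j : ℤ} (h : HorizAt e i j)
    (h' : HorizAt e' i j) : e = e' := by
  obtain ⟨p, q, rfl, h₁, h₂, h₃, h₄⟩ := h
  obtain ⟨p', q', rfl, h₁', h₂', h₃', h₄'⟩ := h'
  rw [vertex_ext (p := p) (q := p') (by omega) (by omega),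
    vertex_ext (p := q) (q := q') (by omega) (by omega)]

lemma VertAt.unique {e e' : Sym2 (Fin m × Fin n)} {i j : ℤ} (h : VertAt e i j)
    (h' : VertAt e' i j) : e = e' := by
  obtain ⟨p, q, rfl, h₁, h₂, h₃, h₄⟩ := h
  obtain ⟨p', q', rfl, h₁', h₂', h₃', h₄'⟩ := h'
  rw [vertex_ext (p := p) (q := p') (by omega) (by omega),
    vertex_ext (p := q) (q := q') (by omega) (by omega)]

lemma HorizAt.index {e : Sym2 (Fin m × Fin n)} {i j i' j' : ℤ} (h : HorizAt e i j)
    (h' : HorizAt e i' j') : i = i' ∧ j = j' := by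
  obtain ⟨p, q, rfl, h₁, h₂, h₃, h₄⟩ := h
  obtain ⟨p', q', e, h₁', h₂', h₃', h₄'⟩ := h'
  rcases Sym2.eq_iff.1 e with ⟨rfl, rfl⟩ | ⟨rfl, rfl⟩ <;> omega

lemma VertAt.index {e : Sym2 (Fin m × Fin n)} {i j i' j' : ℤ} (h : VertAt e i j)
    (h' : VertAt e i' j') : i = i' ∧ j = j' := by
  obtain ⟨p, q, rfl, h₁, h₂, h₃, h₄⟩ := h
  obtain ⟨p', q', e, h₁', h₂', h₃', h₄'⟩ := h'
  rcases Sym2.eq_iff.1 e with ⟨rfl, rfl⟩ | ⟨rfl, rfl⟩ <;> omega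

lemma HorizAt.not_vertAt {e : Sym2 (Fin m × Fin n)} {i j i' j' : ℤ} (h : HorizAt e i j) :
    ¬ VertAt e i' j' := by
  rintro ⟨p', q', e, h₁', h₂', h₃', h₄'⟩
  obtain ⟨p, q, rfl, h₁, h₂, h₃, h₄⟩ := h
  rcases Sym2.eq_iff.1 e with ⟨rfl, rfl⟩ | ⟨rfl, rfl⟩ <;> omega

lemma HorizAt.bounds {e : Sym2 (Fin m × Fin n)} {i j : ℤ} (h : HorizAt e i j) :
    0 < i ∧ i < m ∧ 0 ≤ j ∧ j < n := by
  obtain ⟨p, q, rfl, h₁, h₂, h₃, h₄⟩ := h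
  have := q.1.2
  have := q.2.2
  omega

lemma VertAt.bounds {e : Sym2 (Fin m × Fin n)} {i j : ℤ} (h : VertAt e i j) :
    0 ≤ i ∧ i < m ∧ 0 < j ∧ j < n := by
  obtain ⟨p, q, rfl, h₁, h₂, h₃, h₄⟩ := h
  have := q.1.2
  have := q.2.2
  omega

lemma grid_adj_cases {p q : Fin m × Fin n} (h : (grid m n).Adj p q) :
    HorizAt s(p, q) (p.1 + 1) p.2 ∨ HorizAt s(p, q) p.1 p.2 ∨
      VertAt s(p, q) p.1 (p.2 + 1) ∨ VertAt s(p, q) p.1 p.2 := by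
  rw [SimpleGraph.boxProd_adj, SimpleGraph.pathGraph_adj, SimpleGraph.pathGraph_adj] at h
  rcases h with ⟨h | h, e⟩ | ⟨h | h, e⟩
  · exact Or.inl ⟨p, q, rfl, rfl, by omega, rfl, by rw [e]⟩
  · exact Or.inr (Or.inl ⟨q, p, Sym2.eq_swap, by omega, rfl, by rw [e], rfl⟩)
  · exact Or.inr (Or.inr (Or.inl ⟨p, q, rfl, rfl, by rw [e], rfl, by omega⟩))
  · exact Or.inr (Or.inr (Or.inr ⟨q, p, Sym2.eq_swap, by rw [e], rfl, by omega, rfl⟩))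

open Classical in
/-- Whether the set `S` has the horizontal edge ending at `(i, j)`, as a number. -/
noncomputable def horizInd (S : Set (Sym2 (Fin m × Fin n))) (i j : ℤ) : ℤ :=
  if ∃ e, e ∈ S ∧ HorizAt e i j then 1 else 0

open Classical in
/-- Whether the set `S` has the vertical edge ending at `(i, j)`, as a number. -/
noncomputable def vertInd (S : Set (Sym2 (Fin m × Fin n))) (i j : ℤ) : ℤ :=
  if ∃ e, e ∈ S ∧ VertAt e i j then 1 else 0

lemma horizInd_cases (S : Set (Sym2 (Fin m × Fin n))) (i j : ℤ) :
    horizInd S i j = 0 ∨ horizInd S i j = 1 := by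
  unfold horizInd; split_ifs <;> simp

lemma vertInd_cases (S : Set (Sym2 (Fin m × Fin n))) (i j : ℤ) :
    vertInd S i j = 0 ∨ vertInd S i j = 1 := by
  unfold vertInd; split_ifs <;> simp

lemma horizInd_eq_zero (S : Set (Sym2 (Fin m × Fin n))) {i j : ℤ}
    (h : ¬ (0 < i ∧ i < m ∧ 0 ≤ j ∧ j < n)) : horizInd S i j = 0 :=
  if_neg fun ⟨_, _, he⟩ => h he.bounds

lemma vertInd_eq_zero (S : Set (Sym2 (Fin m × Fin n))) {i j : ℤ}
    (h : ¬ (0 ≤ i ∧ i < m ∧ 0 < j ∧ j < n)) : vertInd S i j = 0 :=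
  if_neg fun ⟨_, _, he⟩ => h he.bounds

open Classical in
lemma HorizAt.ite_mem {e : Sym2 (Fin m × Fin n)} {i j : ℤ} (h : HorizAt e i j)
    (S : Set (Sym2 (Fin m × Fin n))) : (if e ∈ S then 1 else 0 : ℤ) = horizInd S i j := by
  rw [horizInd]
  congr 1
  exact propext ⟨fun he => ⟨e, he, h⟩, fun ⟨e', he, h'⟩ => h.unique h' ▸ he⟩

open Classical in
lemma VertAt.ite_mem {e : Sym2 (Fin m × Fin n)} {i j : ℤ} (h : VertAt e i j)
    (S : Set (Sym2 (Fin m × Fin n))) : (if e ∈ S then 1 else 0 : ℤ) = vertInd S i j := by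
  rw [vertInd]
  congr 1
  exact propext ⟨fun he => ⟨e, he, h⟩, fun ⟨e', he, h'⟩ => h.unique h' ▸ he⟩

lemma sum_ite_of_unique {α : Type*} (s : Finset α) (P : α → Prop) [DecidablePred P]
    [Decidable (∃ a ∈ s, P a)]
    (h : ∀ a ∈ s, ∀ b ∈ s, P a → P b → a = b) :
    ∑ a ∈ s, (if P a then 1 else 0 : ℤ) = if ∃ a ∈ s, P a then 1 else 0 := by
  split_ifs with hP
  · obtain ⟨a, ha, hPa⟩ := hP
    rw [Finset.sum_eq_single a, if_pos hPa]
    · intro b hb hne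
      exact if_neg fun hPb => hne (h b hb a ha hPb hPa)
    · exact fun h => absurd ha h
  · exact Finset.sum_eq_zero fun a ha => if_neg fun hPa => hP ⟨a, ha, hPa⟩

lemma horizInd_symmDiff (S T : Set (Sym2 (Fin m × Fin n))) (i j : ℤ) :
    horizInd (symmDiff S T) i j = (horizInd S i j - horizInd T i j) ^ 2 := by
  by_cases h : ∃ e : Sym2 (Fin m × Fin n), HorizAt e i j
  · obtain ⟨e, he⟩ := h
    rw [← he.ite_mem, ← he.ite_mem, ← he.ite_mem, Set.mem_symmDiff]
    by_cases h₁ : e ∈ S <;> by_cases h₂ : e ∈ T <;> simp [h₁, h₂]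
  · rw [horizInd, horizInd, horizInd, if_neg, if_neg, if_neg] <;> simp_all

lemma vertInd_symmDiff (S T : Set (Sym2 (Fin m × Fin n))) (i j : ℤ) :
    vertInd (symmDiff S T) i j = (vertInd S i j - vertInd T i j) ^ 2 := by
  by_cases h : ∃ e : Sym2 (Fin m × Fin n), VertAt e i j
  · obtain ⟨e, he⟩ := h
    rw [← he.ite_mem, ← he.ite_mem, ← he.ite_mem, Set.mem_symmDiff]
    by_cases h₁ : e ∈ S <;> by_cases h₂ : e ∈ T <;> simp [h₁, h₂]
  · rw [vertInd, vertInd, vertInd, if_neg, if_neg, if_neg] <;> simp_all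

lemma boxSum_ite_of_unique (P : ℤ → ℤ → Prop) [∀ i j, Decidable (P i j)]
    [Decidable (∃ i j, P i j)]
    (hP : ∀ i j, P i j → 0 ≤ i ∧ i < m ∧ 0 ≤ j ∧ j < n)
    (hu : ∀ i j i' j', P i j → P i' j' → i = i' ∧ j = j') :
    boxSum m n (fun i j => if P i j then 1 else 0) = if ∃ i j, P i j then 1 else 0 := by
  classical
  rw [boxSum, ← Finset.sum_product', sum_ite_of_unique _ (fun x : ℕ × ℕ => P x.1 x.2)]
  · refine if_congr ?_ rfl rfl
    refine ⟨fun ⟨x, _, h⟩ => ⟨_, _, h⟩, fun ⟨i, j, h⟩ => ?_⟩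
    have := hP i j h
    refine ⟨(i.toNat, j.toNat), ?_, ?_⟩
    · simp only [Finset.mem_product, Finset.mem_range]; omega
    · rwa [Int.toNat_of_nonneg this.1, Int.toNat_of_nonneg this.2.2.1]
  · rintro ⟨a, b⟩ _ ⟨c, d⟩ _ h h'
    have := hu _ _ _ _ h h'
    exact Prod.ext (by simpa using this.1) (by simpa using this.2)

/-- The number of edges in a set of edges of the grid. -/
lemma ncard_eq_boxSum {S : Set (Sym2 (Fin m × Fin n))} (hS : S ⊆ (grid m n).edgeSet) :
    (S.ncard : ℤ) = boxSum m n (fun i j => horizInd S i j + vertInd S i j) := by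
  classical
  have e₁ : (S.ncard : ℤ) = ∑ e : Sym2 (Fin m × Fin n), if e ∈ S then 1 else 0 := by
    rw [Set.ncard_eq_toFinset_card', Finset.sum_boole]
    congr 2
    ext e; simp
  have h₁ : horizInd S = fun i j =>
      ∑ e : Sym2 (Fin m × Fin n), if e ∈ S ∧ HorizAt e i j then 1 else 0 := by
    funext i j
    rw [sum_ite_of_unique _ (fun e => e ∈ S ∧ HorizAt e i j) fun e _ e' _ h h' => h.2.unique h'.2]
    simp [horizInd]
  have h₂ : vertInd S = fun i j =>
      ∑ e : Sym2 (Fin m × Fin n), if e ∈ S ∧ VertAt e i j then 1 else 0 := by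
    funext i j
    rw [sum_ite_of_unique _ (fun e => e ∈ S ∧ VertAt e i j) fun e _ e' _ h h' => h.2.unique h'.2]
    simp [vertInd]
  have e₂ : ∀ f : Sym2 (Fin m × Fin n) → ℤ → ℤ → ℤ,
      boxSum m n (fun i j => ∑ e, f e i j) = ∑ e, boxSum m n (f e) := fun f => by
    simp only [boxSum]
    exact (Finset.sum_congr rfl fun i _ => Finset.sum_comm).trans Finset.sum_comm
  rw [e₁, boxSum_add]
  rw [h₁, h₂, e₂ fun e i j => if e ∈ S ∧ HorizAt e i j then 1 else 0,
    e₂ fun e i j => if e ∈ S ∧ VertAt e i j then 1 else 0]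
  rw [← Finset.sum_add_distrib]
  refine Finset.sum_congr rfl fun e _ => ?_
  rw [boxSum_ite_of_unique fun i j => e ∈ S ∧ HorizAt e i j,
    boxSum_ite_of_unique fun i j => e ∈ S ∧ VertAt e i j]
  rotate_left
  · rintro i j ⟨-, h⟩; have := h.bounds; omega
  · rintro i j i' j' ⟨-, h⟩ ⟨-, h'⟩; exact h.index h'
  · rintro i j ⟨-, h⟩; have := h.bounds; omega
  · rintro i j i' j' ⟨-, h⟩ ⟨-, h'⟩; exact h.index h'
  by_cases he : e ∈ S
  · have hg := hS he
    induction e using Sym2.ind with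
    | _ p q =>
      have hor : ∀ {i j}, HorizAt s(p, q) i j → (if s(p, q) ∈ S then 1 else 0 : ℤ) =
          (if ∃ i j, s(p, q) ∈ S ∧ HorizAt s(p, q) i j then 1 else 0) +
          if ∃ i j, s(p, q) ∈ S ∧ VertAt s(p, q) i j then 1 else 0 := fun {i j} h => by
        rw [if_pos he, if_pos ⟨i, j, he, h⟩, if_neg fun ⟨_, _, _, h'⟩ => h.not_vertAt h',
          add_zero]
      have ver : ∀ {i j}, VertAt s(p, q) i j → (if s(p, q) ∈ S then 1 else 0 : ℤ) =
          (if ∃ i j, s(p, q) ∈ S ∧ HorizAt s(p, q) i j then 1 else 0) +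
          if ∃ i j, s(p, q) ∈ S ∧ VertAt s(p, q) i j then 1 else 0 := fun {i j} h => by
        rw [if_pos he, if_neg fun ⟨_, _, _, h'⟩ => h'.not_vertAt h, if_pos ⟨i, j, he, h⟩,
          zero_add]
      rcases grid_adj_cases hg with h | h | h | h
      · exact hor h
      · exact hor h
      · exact ver h
      · exact ver h
  · simp [he]

lemma ncard_inter_four {α : Type*} {a b c d : α} (S : Set α) (hab : a ≠ b) (hac : a ≠ c)
    (had : a ≠ d) (hbc : b ≠ c) (hbd : b ≠ d) (hcd : c ≠ d) [DecidablePred (· ∈ S)] :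
    (((({a, b, c, d} : Set α) ∩ S).ncard : ℕ) : ℤ) =
      (if a ∈ S then 1 else 0) + (if b ∈ S then 1 else 0) + (if c ∈ S then 1 else 0) +
        if d ∈ S then 1 else 0 := by
  classical
  have : ({a, b, c, d} : Set α) ∩ S = (({a, b, c, d} : Finset α).filter (· ∈ S) : Finset α) := by
    ext x; simp
  rw [this, Set.ncard_coe_finset, Finset.card_filter]
  push_cast
  rw [Finset.sum_insert (by simp [*]), Finset.sum_insert (by simp [*]),
    Finset.sum_insert (by simp [*]), Finset.sum_singleton]
  ring

lemma signature_eq (C : (grid m n).Subgraph) (c : Cell m n) :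
    (signature C c : ℤ) = horizInd C.edgeSet (c.1 + 1) c.2 + horizInd C.edgeSet (c.1 + 1) (c.2 + 1)
      + vertInd C.edgeSet c.1 (c.2 + 1) + vertInd C.edgeSet (c.1 + 1) (c.2 + 1) := by
  classical
  have h₁ : HorizAt s(c.corner 0 0, c.corner 1 0) (c.1 + 1) c.2 :=
    ⟨_, _, rfl, by simp [Cell.corner], by simp [Cell.corner], by simp [Cell.corner],
      by simp [Cell.corner]⟩
  have h₂ : HorizAt s(c.corner 0 1, c.corner 1 1) (c.1 + 1) (c.2 + 1) :=
    ⟨_, _, rfl, by simp [Cell.corner], by simp [Cell.corner], by simp [Cell.corner],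
      by simp [Cell.corner]⟩
  have h₃ : VertAt s(c.corner 0 0, c.corner 0 1) c.1 (c.2 + 1) :=
    ⟨_, _, rfl, by simp [Cell.corner], by simp [Cell.corner], by simp [Cell.corner],
      by simp [Cell.corner]⟩
  have h₄ : VertAt s(c.corner 1 0, c.corner 1 1) (c.1 + 1) (c.2 + 1) :=
    ⟨_, _, rfl, by simp [Cell.corner], by simp [Cell.corner], by simp [Cell.corner],
      by simp [Cell.corner]⟩
  rw [signature, Cell.edges, ncard_inter_four, h₁.ite_mem, h₂.ite_mem, h₃.ite_mem, h₄.ite_mem]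
  · intro e
    have := (h₁.index (e ▸ h₂)).2
    omega
  · exact fun e => h₁.not_vertAt (e ▸ h₃)
  · exact fun e => h₁.not_vertAt (e ▸ h₄)
  · exact fun e => h₂.not_vertAt (e ▸ h₃)
  · exact fun e => h₂.not_vertAt (e ▸ h₄)
  · intro e
    have := (h₃.index (e ▸ h₄)).1
    omega

end Edges

/-! ### Cells enclosed by a cycle -/

section Interior

variable {m n : ℕ}

/-- Even degrees are all that the construction of the interior takes from `IsCycle`; connectedness
plays no role. -/
lemma two_dvd_degree {V : Type*} {G : SimpleGraph V} {C : G.Subgraph} (h : IsCycle C) (p : V) :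
    2 ∣ (C.neighborSet p).ncard := by
  obtain ⟨u, w, hw, rfl⟩ := h
  by_cases hp : p ∈ w.support
  · rw [hw.ncard_neighborSet_toSubgraph_eq_two hp]
  · have : w.toSubgraph.neighborSet p = ∅ := by
      refine Set.eq_empty_iff_forall_notMem.2 fun q hq => hp ?_
      exact w.mem_verts_toSubgraph.1 (w.toSubgraph.edge_vert hq)
    rw [this, Set.ncard_empty]
    exact dvd_zero 2

lemma degree_eq (C : (grid m n).Subgraph) (p : Fin m × Fin n) :
    ((C.neighborSet p).ncard : ℤ) =
      horizInd C.edgeSet (p.1 + 1) p.2 + horizInd C.edgeSet p.1 p.2 +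
        vertInd C.edgeSet p.1 (p.2 + 1) + vertInd C.edgeSet p.1 p.2 := by
  classical
  have hor : ∀ i j : ℤ, (∀ e : Sym2 (Fin m × Fin n), HorizAt e i j → p ∈ e) →
      horizInd C.edgeSet i j =
        ∑ q, if s(p, q) ∈ C.edgeSet ∧ HorizAt s(p, q) i j then 1 else 0 := fun i j h => by
    rw [sum_ite_of_unique _ (fun q => s(p, q) ∈ C.edgeSet ∧ HorizAt s(p, q) i j)
      fun q _ q' _ h h' => Sym2.congr_right.1 (h.2.unique h'.2), horizInd]
    refine if_congr ⟨fun ⟨e, he, he'⟩ => ?_, fun ⟨q, _, hq⟩ => ⟨_, hq⟩⟩ rfl rfl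
    obtain ⟨q, rfl⟩ := h e he'
    exact ⟨q, Finset.mem_univ q, he, he'⟩
  have ver : ∀ i j : ℤ, (∀ e : Sym2 (Fin m × Fin n), VertAt e i j → p ∈ e) →
      vertInd C.edgeSet i j =
        ∑ q, if s(p, q) ∈ C.edgeSet ∧ VertAt s(p, q) i j then 1 else 0 := fun i j h => by
    rw [sum_ite_of_unique _ (fun q => s(p, q) ∈ C.edgeSet ∧ VertAt s(p, q) i j)
      fun q _ q' _ h h' => Sym2.congr_right.1 (h.2.unique h'.2), vertInd]
    refine if_congr ⟨fun ⟨e, he, he'⟩ => ?_, fun ⟨q, _, hq⟩ => ⟨_, hq⟩⟩ rfl rfl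
    obtain ⟨q, rfl⟩ := h e he'
    exact ⟨q, Finset.mem_univ q, he, he'⟩
  rw [hor, hor, ver, ver]
  rotate_left
  · rintro e ⟨a, b, rfl, h₁, h₂, h₃, h₄⟩
    rw [vertex_ext (p := p) (q := b) (by omega) (by omega)]; exact Sym2.mem_mk_right _ _
  · rintro e ⟨a, b, rfl, h₁, h₂, h₃, h₄⟩
    rw [vertex_ext (p := p) (q := a) (by omega) (by omega)]; exact Sym2.mem_mk_left _ _
  · rintro e ⟨a, b, rfl, h₁, h₂, h₃, h₄⟩
    rw [vertex_ext (p := p) (q := b) (by omega) (by omega)]; exact Sym2.mem_mk_right _ _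
  · rintro e ⟨a, b, rfl, h₁, h₂, h₃, h₄⟩
    rw [vertex_ext (p := p) (q := a) (by omega) (by omega)]; exact Sym2.mem_mk_left _ _
  rw [Set.ncard_eq_toFinset_card', ← Finset.sum_add_distrib, ← Finset.sum_add_distrib,
    ← Finset.sum_add_distrib]
  have : ((C.neighborSet p).toFinset.card : ℤ) =
      ∑ q, if s(p, q) ∈ C.edgeSet then 1 else 0 := by
    rw [Finset.sum_boole]
    congr 2
    ext q; simp
  rw [this]
  refine Finset.sum_congr rfl fun q _ => ?_
  by_cases hq : s(p, q) ∈ C.edgeSet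
  · simp only [hq, true_and, if_true]
    have hpq : (grid m n).Adj p q := C.edgeSet_subset hq
    rcases grid_adj_cases hpq with h | h | h | h
    · have h' : ¬ HorizAt s(p, q) p.1 p.2 := fun h' => by have := h.index h'; omega
      simp only [h, h', h.not_vertAt, if_true, if_false, add_zero]
    · have h' : ¬ HorizAt s(p, q) (p.1 + 1) p.2 := fun h' => by have := h.index h'; omega
      simp only [h, h', h.not_vertAt, if_true, if_false, add_zero, zero_add]
    · have h' : ¬ VertAt s(p, q) p.1 p.2 := fun h' => by have := h.index h'; omega
      have h'' : ∀ i j, ¬ HorizAt s(p, q) i j := fun i j h' => h'.not_vertAt h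
      simp only [h, h', h'', if_true, if_false, add_zero, zero_add]
    · have h' : ¬ VertAt s(p, q) p.1 (p.2 + 1) := fun h' => by have := h.index h'; omega
      have h'' : ∀ i j, ¬ HorizAt s(p, q) i j := fun i j h' => h'.not_vertAt h
      simp only [h, h', h'', if_true, if_false, add_zero, zero_add]
  · simp [hq]

lemma degree_even {C : (grid m n).Subgraph} (h : IsCycle C) (x y : ℤ) :
    2 ∣ horizInd C.edgeSet (x + 1) y + horizInd C.edgeSet x y +
      vertInd C.edgeSet x (y + 1) + vertInd C.edgeSet x y := by
  by_cases hxy : (0 ≤ x ∧ x < m) ∧ 0 ≤ y ∧ y < n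
  · obtain ⟨⟨hx, hx'⟩, hy, hy'⟩ := hxy
    have := degree_eq C (⟨x.toNat, by omega⟩, ⟨y.toNat, by omega⟩)
    simp only [Int.toNat_of_nonneg hx, Int.toNat_of_nonneg hy] at this
    rw [← this]
    exact_mod_cast two_dvd_degree h _
  · rw [horizInd_eq_zero _ (by omega), horizInd_eq_zero _ (by omega), vertInd_eq_zero _ (by omega),
      vertInd_eq_zero _ (by omega)]
    norm_num

/-- The indicator of the set of cells enclosed by a cycle. -/
lemma exists_interior {C : (grid m n).Subgraph} (h : IsCycle C) :
    ∃ a : ℤ → ℤ → ℤ, (∀ i j, a i j = 0 ∨ a i j = 1) ∧ (∀ i j, ¬ Inner m n i j → a i j = 0) ∧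
      (∀ i j, horizInd C.edgeSet i j = (a i j - a i (j + 1)) ^ 2) ∧
      ∀ i j, vertInd C.edgeSet i j = (a i j - a (i + 1) j) ^ 2 := by
  set S := C.edgeSet with hS
  -- Ray casting: `u i j` counts the edges of `C` crossed by a vertical ray going down from the cell
  -- with upper right corner `(i, j)`. Its parity is the indicator.
  set u : ℤ → ℤ → ℤ := fun i j => ∑ k ∈ Finset.range j.toNat, horizInd S i k with hu
  have u_nonpos : ∀ i j : ℤ, j ≤ 0 → u i j = 0 := fun i j hj => by
    simp [hu, Int.toNat_of_nonpos hj]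
  have u_succ : ∀ i j : ℤ, u i (j + 1) = u i j + horizInd S i j := by
    intro i j
    rcases le_or_gt 0 j with hj | hj
    · simp only [hu]
      rw [show (j + 1).toNat = j.toNat + 1 by omega, Finset.sum_range_succ,
        Int.toNat_of_nonneg hj]
    · rw [u_nonpos _ _ (by omega), u_nonpos _ _ hj.le, horizInd_eq_zero _ (by omega), add_zero]
  have u_side : ∀ i j : ℤ, 2 ∣ u i j + u (i + 1) j + vertInd S i j := by
    intro i j
    rcases le_or_gt j 0 with hj | hj
    · rw [u_nonpos _ _ hj, u_nonpos _ _ hj, vertInd_eq_zero _ (by omega)]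
      norm_num
    · obtain ⟨k, rfl⟩ := Int.eq_ofNat_of_zero_le hj.le
      clear hj
      induction k with
      | zero =>
        rw [u_nonpos _ _ (by simp), u_nonpos _ _ (by simp), vertInd_eq_zero _ (by simp)]
        norm_num
      | succ k ih =>
        have := degree_even h i k
        rw [← hS] at this
        push_cast
        rw [u_succ, u_succ]
        omega
  have u_left : ∀ i j : ℤ, i ≤ 0 → u i j = 0 := fun i j hi =>
    Finset.sum_eq_zero fun k _ => horizInd_eq_zero _ (by omega)
  have u_right : ∀ i j : ℤ, m ≤ i → u i j = 0 := fun i j hi =>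
    Finset.sum_eq_zero fun k _ => horizInd_eq_zero _ (by omega)
  -- Above the grid there are no vertical edges, so the parity is carried unchanged from the left,
  -- where `u` is zero.
  have u_top : ∀ i j : ℤ, n ≤ j → 2 ∣ u i j := by
    intro i j hj
    rcases le_or_gt i 0 with hi | hi
    · rw [u_left _ _ hi]; norm_num
    · obtain ⟨k, rfl⟩ := Int.eq_ofNat_of_zero_le hi.le
      clear hi
      induction k with
      | zero => rw [u_left _ _ (by simp)]; norm_num
      | succ k ih =>
        have := u_side k j
        rw [vertInd_eq_zero _ (by omega)] at this
        push_cast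
        omega
  refine ⟨fun i j => u i j % 2, fun i j => Int.emod_two_eq_zero_or_one _, fun i j hij => ?_,
    fun i j => ?_, fun i j => ?_⟩
  · have : i ≤ 0 ∨ m ≤ i ∨ j ≤ 0 ∨ n ≤ j := by
      by_contra hh
      exact hij ⟨⟨by omega, by omega⟩, by omega, by omega⟩
    rcases this with h | h | h | h
    · simp only [u_left _ _ h]; norm_num
    · simp only [u_right _ _ h]; norm_num
    · simp only [u_nonpos _ _ h]; norm_num
    · exact Int.emod_eq_zero_of_dvd (u_top _ _ h)
  · have e := u_succ i j
    have e₁ := Int.emod_two_eq_zero_or_one (u i j)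
    have e₂ := Int.emod_two_eq_zero_or_one (u i (j + 1))
    rcases horizInd_cases S i j with h | h <;> rw [h] at e ⊢ <;> rcases e₁ with e₁ | e₁ <;>
      rcases e₂ with e₂ | e₂ <;> simp only [e₁, e₂] <;> omega
  · have e := u_side i j
    have e₁ := Int.emod_two_eq_zero_or_one (u i j)
    have e₂ := Int.emod_two_eq_zero_or_one (u (i + 1) j)
    rcases vertInd_cases S i j with h | h <;> rw [h] at e ⊢ <;> rcases e₁ with e₁ | e₁ <;>
      rcases e₂ with e₂ | e₂ <;> simp only [e₁, e₂] <;> omega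

end Interior

/-! ### From cycles to sign pairs -/

/-- The enclosed cells of two cycles with the same signature. -/
lemma signPair_of_signature {m n : ℕ} {C₁ C₂ : (grid m n).Subgraph}
    (hsig : signature C₁ = signature C₂) {a b : ℤ → ℤ → ℤ}
    (ha : ∀ i j, a i j = 0 ∨ a i j = 1) (hb : ∀ i j, b i j = 0 ∨ b i j = 1)
    (ha₀ : ∀ i j, ¬ Inner m n i j → a i j = 0) (hb₀ : ∀ i j, ¬ Inner m n i j → b i j = 0)
    (hah : ∀ i j, horizInd C₁.edgeSet i j = (a i j - a i (j + 1)) ^ 2)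
    (hav : ∀ i j, vertInd C₁.edgeSet i j = (a i j - a (i + 1) j) ^ 2)
    (hbh : ∀ i j, horizInd C₂.edgeSet i j = (b i j - b i (j + 1)) ^ 2)
    (hbv : ∀ i j, vertInd C₂.edgeSet i j = (b i j - b (i + 1) j) ^ 2) :
    SignPair m n (fun i j => a i j - b i j) (fun i j => a i j + b i j - 1) := by
  have key : ∀ i j, Inner m n i j →
      (a i j - b i j) * nbrSum (fun i j => a i j + b i j - 1) i j +
        (a i j + b i j - 1) * nbrSum (fun i j => a i j - b i j) i j = 0 := by
    rintro i j ⟨⟨hi, hi'⟩, hj, hj'⟩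
    -- A `Cell` is labelled by its lower left corner, `a` and `b` by the upper right one.
    let c : Cell m n := (⟨(i - 1).toNat, by omega⟩, ⟨(j - 1).toNat, by omega⟩)
    have e₁ := signature_eq C₁ c
    have e₂ := signature_eq C₂ c
    have c₁ : ((c.1 : ℕ) : ℤ) = i - 1 := Int.toNat_of_nonneg (by omega)
    have c₂ : ((c.2 : ℕ) : ℤ) = j - 1 := Int.toNat_of_nonneg (by omega)
    rw [c₁, c₂, sub_add_cancel, sub_add_cancel] at e₁ e₂
    rw [hsig, e₂, hah, hah, hav, hav, hbh, hbh, hbv, hbv, sub_add_cancel, sub_add_cancel] at e₁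
    simp only [nbrSum]
    have sq : ∀ f : ℤ → ℤ → ℤ, (∀ i j, f i j = 0 ∨ f i j = 1) → ∀ i j, f i j ^ 2 = f i j :=
      fun f hf i j => by rcases hf i j with h | h <;> rw [h] <;> norm_num
    linear_combination e₁ + sq a ha (i + 1) j + sq a ha (i - 1) j + sq a ha i (j + 1) +
      sq a ha i (j - 1) + 4 * sq a ha i j - sq b hb (i + 1) j - sq b hb (i - 1) j -
      sq b hb i (j + 1) - sq b hb i (j - 1) - 4 * sq b hb i j
  refine ⟨fun i j => ?_, fun i j hij => ?_, fun i j hij hk => ?_, fun i j hk => ?_⟩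
  · rcases ha i j with h | h <;> rcases hb i j with h' | h' <;> simp [h, h']
  · simp [ha₀ i j hij, hb₀ i j hij]
  · have := key i j hij
    rw [hk, zero_mul, zero_add] at this
    refine (mul_eq_zero.1 this).resolve_left fun h0 => ?_
    rcases ha i j with h | h <;> rcases hb i j with h' | h' <;> omega
  · have hij : Inner m n i j := by
      by_contra hij
      exact hk (by simp [ha₀ i j hij, hb₀ i j hij])
    have hl : a i j + b i j - 1 = 0 := by
      rcases ha i j with h | h <;> rcases hb i j with h' | h' <;> simp [h, h'] at hk ⊢
    have := key i j hij
    rw [hl, zero_mul, add_zero] at this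
    exact (mul_eq_zero.1 this).resolve_left hk

/-- Each edge of the difference is counted once, from whichever of its two cells has `k ≠ 0`. -/
lemma ncard_difference_eq {m n : ℕ} {C₁ C₂ : (grid m n).Subgraph} {k l a b : ℤ → ℤ → ℤ}
    (hk : k = fun i j => a i j - b i j) (hl : l = fun i j => a i j + b i j - 1)
    (h : SignPair m n k l)
    (hah : ∀ i j, horizInd C₁.edgeSet i j = (a i j - a i (j + 1)) ^ 2)
    (hav : ∀ i j, vertInd C₁.edgeSet i j = (a i j - a (i + 1) j) ^ 2)
    (hbh : ∀ i j, horizInd C₂.edgeSet i j = (b i j - b i (j + 1)) ^ 2)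
    (hbv : ∀ i j, vertInd C₂.edgeSet i j = (b i j - b (i + 1) j) ^ 2) :
    ((difference C₁ C₂).ncard : ℤ) =
      boxSum m n (fun i j => k i j ^ 2 * nbrSum (fun i j => l i j ^ 2) i j) := by
  have kl : ∀ i j, k i j * l i j = 0 := fun i j => by
    rcases h.cases i j with ⟨h, -⟩ | ⟨-, h⟩ <;> rw [h] <;> ring
  have hsub : difference C₁ C₂ ⊆ (grid m n).edgeSet := fun e he => by
    rcases he with he | he
    · exact C₁.edgeSet_subset he.1
    · exact C₂.edgeSet_subset he.1
  -- The left side is the square of `(k - k') * (l - l')`; expand with `k * l = k' * l' = 0`.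
  have hd : ∀ x y x' y' : ℤ, (x - y) * (x + y - 1) = 0 → (x' - y') * (x' + y' - 1) = 0 →
      ((x - x') ^ 2 - (y - y') ^ 2) ^ 2 =
        (x - y) ^ 2 * (x' + y' - 1) ^ 2 + (x' - y') ^ 2 * (x + y - 1) ^ 2 := by
    intro x y x' y' h h'
    linear_combination (4 * (x' - y') * (x' + y' - 1) + (x - y) * (x + y - 1) -
      2 * (x - y) * (x' + y' - 1) - 2 * (x' - y') * (x + y - 1)) * h +
      ((x' - y') * (x' + y' - 1) - 2 * (x - y) * (x' + y' - 1) - 2 * (x' - y') * (x + y - 1)) * h'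
  have hk0 : ∀ i j, ¬ Inner m n i j → k i j ^ 2 = 0 := fun i j hij => by
    rw [(h.outer i j hij).1]; norm_num
  have e₁ : boxSum m n (fun i j => k (i + 1) j ^ 2 * l i j ^ 2) =
      boxSum m n (fun i j => k i j ^ 2 * l (i - 1) j ^ 2) := by
    have := sum_range_shift_succ m
      (fun i => ∑ j ∈ Finset.range (n + 1), k i j ^ 2 * l (i - 1) j ^ 2)
      (Finset.sum_eq_zero fun j _ => by rw [hk0 _ _ (by rintro ⟨h, -⟩; omega), zero_mul])
      (Finset.sum_eq_zero fun j _ => by rw [hk0 _ _ (by rintro ⟨h, -⟩; omega), zero_mul])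
    simpa [boxSum] using this
  have e₂ : boxSum m n (fun i j => k i (j + 1) ^ 2 * l i j ^ 2) =
      boxSum m n (fun i j => k i j ^ 2 * l i (j - 1) ^ 2) := by
    refine Finset.sum_congr rfl fun i _ => ?_
    have := sum_range_shift_succ n (fun j => k i j ^ 2 * l i (j - 1) ^ 2)
      (by rw [hk0 _ _ (by rintro ⟨-, h⟩; omega), zero_mul])
      (by rw [hk0 _ _ (by rintro ⟨-, h⟩; omega), zero_mul])
    simpa using this
  rw [ncard_eq_boxSum hsub]
  simp only [difference, horizInd_symmDiff, vertInd_symmDiff, hah, hav, hbh, hbv]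
  have hH : ∀ i j, ((a i j - a i (j + 1)) ^ 2 - (b i j - b i (j + 1)) ^ 2) ^ 2 =
      k i j ^ 2 * l i (j + 1) ^ 2 + k i (j + 1) ^ 2 * l i j ^ 2 := fun i j => by
    have h₁ := kl i j
    have h₂ := kl i (j + 1)
    subst hk hl
    exact hd _ _ _ _ h₁ h₂
  have hV : ∀ i j, ((a i j - a (i + 1) j) ^ 2 - (b i j - b (i + 1) j) ^ 2) ^ 2 =
      k i j ^ 2 * l (i + 1) j ^ 2 + k (i + 1) j ^ 2 * l i j ^ 2 := fun i j => by
    have h₁ := kl i j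
    have h₂ := kl (i + 1) j
    subst hk hl
    exact hd _ _ _ _ h₁ h₂
  simp only [hH, hV, nbrSum, mul_add, boxSum_add, e₁, e₂]
  ring

end Slitherlink

theorem theoremd8 (m n : ℕ) (C₁ C₂ : (Slitherlink.grid m n).Subgraph)
    (h₁ : Slitherlink.IsCycle C₁) (h₂ : Slitherlink.IsCycle C₂)
    (hsig : Slitherlink.signature C₁ = Slitherlink.signature C₂) :
    8 ∣ (Slitherlink.difference C₁ C₂).ncard := by
  obtain ⟨a, ha, ha₀, hah, hav⟩ := Slitherlink.exists_interior h₁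
  obtain ⟨b, hb, hb₀, hbh, hbv⟩ := Slitherlink.exists_interior h₂
  have h := Slitherlink.signPair_of_signature hsig ha hb ha₀ hb₀ hah hav hbh hbv
  have hn : 0 < n := by
    obtain ⟨u, -⟩ := h₁
    exact u.2.pos
  have := h.eight_dvd hn
  rw [← Slitherlink.ncard_difference_eq rfl rfl h hah hav hbh hbv] at this
  exact_mod_cast this
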